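/- Let $\Sigma\in\mathbb R^{d\times d}$ be positive definite, $\sigma>0$ and $\theta\in\mathbb R^d$. There are $m\ge 1$ agents. Agent $i$ has a view given by a permutation matrix $\Pi_i$, $\Pi_i^\top=[\Pi_{i+}^\top\ \Pi_{i-}^\top]$, where $\Pi_{i+}\in\mathbb R^{d_i\times d}$ selects the coordinates it observes and $\Pi_{i-}\in\mathbb R^{(d-d_i)\times d}$ those it does not observe. Write $v_{i\pm}$ for $\Pi_{i\pm}v$ (subvectors), $\Sigma_{i+}=\Pi_{i+}\Sigma\Pi_{i+}^\top$, $\Sigma_{i-}=\Pi_{i-}\Sigma\Pi_{i-}^\top$, $\Sigma_{i\pm}=\Pi_{i+}\Sigma\Pi_{i-}^\top$ and $\Sigma_{i\mp}=\Pi_{i-}\Sigma\Pi_{i+}^\top$ (blocks), and put $$T_i=\begin{bmatrix} I_{d_i} & \Sigma_{i+}^{-1}\Sigma_{i\pm}\end{bmatrix}\Pi_i,\qquad \Gamma_{i-}=\Sigma_{i-}-\Sigma_{i\mp}\Sigma_{i+}^{-1}\Sigma_{i\pm},\qquad \|\theta_{i-}\|_{\Gamma_{i-}}^2=\theta_{i-}^\top\Gamma_{i-}\theta_{i-},$$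 $$C^{s}=\Big(\sum_{i=1}^m\frac{2\Sigma}{\|\theta_{i-}\|_{\Gamma_{i-}}^2+\sigma^2}\Big)^{-1}.$$ *Observation model.* Given $n$ and observed feature matrices $X_{i+}\in\mathbb R^{n\times d_i}$, $i\in[m]$, with rows $x_{i+}^{(k)}$, and a parameter $\theta'\in\mathbb R^d$, let $P^y_{\theta'}$ be the law of all labels $y=(y_i^{(k)})_{i\le m,\,k\le n}$, $$y_i^{(k)}=\langle x_{i+}^{(k)},\theta'_{i+}\rangle+\langle x_{i-}^{(k)},\theta'_{i-}\rangle+\xi_i^{(k)},\qquad x_{i-}^{(k)}\sim\mathsf N(\Sigma_{i\mp}\Sigma_{i+}^{-1}x_{i+}^{(k)},\Gamma_{i-}),\quad \xi_i^{(k)}\sim\mathsf N(0,\sigma^2),$$ where all $x_{i-}^{(k)}$ and $\xi_i^{(k)}$ are independent. For a target $\psi:\mathbb R^d\to\mathbb R^s$, $u\in\mathbb R^s$ and $c>0$, define the local minimax risk around $\theta$ $$R_{n,c}(\psi,u)=\inf_{\bar\theta}\ \sup_{\|\theta'-\theta\|_2\le c\,n^{-1/2}} n\,\mathbb E_{y\sim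 P^y_{\theta'}}\big\langle u,\ \bar\theta(y,X_{1+},\dots,X_{m+})-\psi(\theta')\big\rangle^2\in[0,\infty],$$ the infimum being over all measurable functions $\bar\theta$ of the labels and the observed features with values in $\mathbb R^s$. **Theorem.** On some probability space let there be, for every $n$ and every $i\in[m]$, a random matrix $X_{i+}=X_{i+}^{(n)}\in\mathbb R^{n\times d_i}$ whose $n$ rows are i.i.d. $\mathsf N(0,\Sigma_{i+})$ (the joint dependence between different $i$ and different $n$ may be arbitrary). Then: 1. for every $u\in\mathbb R^d$, with probability $1$ over the features, $$\liminf_{c\to\infty}\liminf_{n\to\infty}R_{n,c}(\mathrm{id},u)\ \ge\ u^\top C^{s}u;$$ 2. for every $i\in[m]$ and every $u\in\mathbb R^{d_i}$, with probability $1$ over the features, $$\liminf_{c\to\infty}\liminf_{n\to\infty}R_{n,c}(\theta'\mapsto T_i\theta',u)\ \ge\ u^\top T_iC^{s}T_i^\top u.$$ -/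

import Mathlib

open MeasureTheory ProbabilityTheory Filter
open scoped ENNReal Matrix

noncomputable section

/-- A view of an agent on `ℝ^d`: it observes `numObs` of the `d` coordinates and misses the other
`numMis`. The bijection `perm` is the permutation `Π = [Π₊; Π₋]`: `perm (inl a)` is the `a`-th
observed coordinate and `perm (inr b)` is the `b`-th missing one. -/
structure AgentView (d : ℕ) where
  numObs : ℕ
  numMis : ℕ
  perm : Fin numObs ⊕ Fin numMis ≃ Fin d

namespace AgentView

variable {d : ℕ} (V : AgentView d)

/-- The subvector `v₊ = Π₊ v` of observed coordinates. -/
def obs (v : EuclideanSpace ℝ (Fin d)) : EuclideanSpace ℝ (Fin V.numObs) :=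
  WithLp.toLp 2 fun a => v (V.perm (Sum.inl a))

/-- The subvector `v₋ = Π₋ v` of missing coordinates. -/
def mis (v : EuclideanSpace ℝ (Fin d)) : EuclideanSpace ℝ (Fin V.numMis) :=
  WithLp.toLp 2 fun b => v (V.perm (Sum.inr b))

/-- `A₊ = Π₊ A Π₊ᵀ`. -/
def blockPlus (A : Matrix (Fin d) (Fin d) ℝ) : Matrix (Fin V.numObs) (Fin V.numObs) ℝ :=
  A.submatrix (fun a => V.perm (Sum.inl a)) (fun a => V.perm (Sum.inl a))

/-- `A₋ = Π₋ A Π₋ᵀ`. -/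
def blockMinus (A : Matrix (Fin d) (Fin d) ℝ) : Matrix (Fin V.numMis) (Fin V.numMis) ℝ :=
  A.submatrix (fun b => V.perm (Sum.inr b)) (fun b => V.perm (Sum.inr b))

/-- `A_± = Π₊ A Π₋ᵀ`. -/
def blockPM (A : Matrix (Fin d) (Fin d) ℝ) : Matrix (Fin V.numObs) (Fin V.numMis) ℝ :=
  A.submatrix (fun a => V.perm (Sum.inl a)) (fun b => V.perm (Sum.inr b))

/-- `A_∓ = Π₋ A Π₊ᵀ`. -/
def blockMP (A : Matrix (Fin d) (Fin d) ℝ) : Matrix (Fin V.numMis) (Fin V.numObs) ℝ :=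
  A.submatrix (fun b => V.perm (Sum.inr b)) (fun a => V.perm (Sum.inl a))

/-- `T = [I, Σ₊⁻¹ Σ_±] Π`. -/
def T (S : Matrix (Fin d) (Fin d) ℝ) : Matrix (Fin V.numObs) (Fin d) ℝ :=
  (Matrix.fromCols 1 ((V.blockPlus S)⁻¹ * V.blockPM S)).submatrix id V.perm.symm

/-- The Schur complement `Γ₋ = Σ₋ - Σ_∓ Σ₊⁻¹ Σ_±`, the conditional covariance of the missing
features given the observed ones. -/
def schur (S : Matrix (Fin d) (Fin d) ℝ) : Matrix (Fin V.numMis) (Fin V.numMis) ℝ :=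
  V.blockMinus S - V.blockMP S * (V.blockPlus S)⁻¹ * V.blockPM S

/-- The conditional mean `μ₋ = Σ_∓ Σ₊⁻¹ x₊` of the missing features given the observed ones. -/
def condMean (S : Matrix (Fin d) (Fin d) ℝ) (x : EuclideanSpace ℝ (Fin V.numObs)) :
    EuclideanSpace ℝ (Fin V.numMis) :=
  WithLp.toLp 2 ((V.blockMP S * (V.blockPlus S)⁻¹) *ᵥ x.ofLp)

/-- The quadratic form `‖θ₋‖²_{Γ₋} = ⟨θ₋, Γ₋ θ₋⟩`. -/
def misVar (S : Matrix (Fin d) (Fin d) ℝ) (θ : EuclideanSpace ℝ (Fin d)) : ℝ :=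
  (V.mis θ).ofLp ⬝ᵥ (V.schur S *ᵥ (V.mis θ).ofLp)

/-- The law of one label `y = ⟨x₊, θ₊⟩ + ⟨x₋, θ₋⟩ + ξ` for a fixed observed feature vector `x₊`,
where `x₋ ∼ N(μ₋, Γ₋)` and `ξ ∼ N(0, σ²)` are independent. -/
def labelLaw (S : Matrix (Fin d) (Fin d) ℝ) (σ : ℝ) (θ : EuclideanSpace ℝ (Fin d))
    (x : EuclideanSpace ℝ (Fin V.numObs)) : Measure ℝ :=
  ((multivariateGaussian (V.condMean S x) (V.schur S)).prod
      (gaussianReal 0 (σ ^ 2).toNNReal)).map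
    fun p => inner ℝ x (V.obs θ) + inner ℝ p.1 (V.mis θ) + p.2

end AgentView

/-- All observed features: agent `i` has the `n` rows `x i k` of its matrix `X_{i+}`. -/
abbrev ObsFeatures {d m : ℕ} (V : Fin m → AgentView d) (n : ℕ) : Type :=
  (i : Fin m) → Fin n → EuclideanSpace ℝ (Fin (V i).numObs)

/-- All labels: agent `i` has the `n` labels `y i k`. -/
abbrev Labels (m n : ℕ) : Type := Fin m → Fin n → ℝ

/-- The law `P_θ^y` of all labels of all agents given the observed features; labels are
independent across samples and agents. -/
def labelsLaw {d m : ℕ} (V : Fin m → AgentView d) (S : Matrix (Fin d) (Fin d) ℝ) (σ : ℝ) {n : ℕ}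
    (x : ObsFeatures V n) (θ : EuclideanSpace ℝ (Fin d)) : Measure (Labels m n) :=
  Measure.pi fun i => Measure.pi fun k => (V i).labelLaw S σ θ (x i k)

/-- The local minimax risk
`inf_est sup_{‖θ' - θ‖ ≤ c n^{-1/2}} n E_{y ∼ P_θ'} ⟨u, est(y, x) - ψ(θ')⟩²` for the target `ψ`,
the infimum being over all measurable functions of the labels and the observed features. -/
def localMinimaxRisk {d m s : ℕ} (V : Fin m → AgentView d) (S : Matrix (Fin d) (Fin d) ℝ) (σ : ℝ)
    (ψ : EuclideanSpace ℝ (Fin d) → EuclideanSpace ℝ (Fin s)) (θ : EuclideanSpace ℝ (Fin d))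
    (c : ℝ) (n : ℕ) (x : ObsFeatures V n) (u : EuclideanSpace ℝ (Fin s)) : ℝ≥0∞ :=
  ⨅ (est : Labels m n × ObsFeatures V n → EuclideanSpace ℝ (Fin s)) (_ : Measurable est),
    ⨆ θ' ∈ Metric.closedBall θ (c / √(n : ℝ)),
      (n : ℝ≥0∞) * ∫⁻ y, ENNReal.ofReal (inner ℝ u (est (y, x) - ψ θ') ^ 2)
        ∂(labelsLaw V S σ x θ')

/-- The strong lower bound matrix `C^s = (∑ᵢ 2 Σ / (‖θ_{i-}‖²_{Γ_{i-}} + σ²))⁻¹`. -/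
def strongBound {d m : ℕ} (V : Fin m → AgentView d) (S : Matrix (Fin d) (Fin d) ℝ) (σ : ℝ)
    (θ : EuclideanSpace ℝ (Fin d)) : Matrix (Fin d) (Fin d) ℝ :=
  (∑ i, (2 / ((V i).misVar S θ + σ ^ 2)) • S)⁻¹

end

/-!
Along a segment `θ + t h` of parameters the van Trees inequality bounds the Bayes risk from below by
`⟨w, h⟩²` over the Fisher information of the labels, up to a prior term that vanishes as `c → ∞`.
Given `x₊`, a label is Gaussian with mean `⟨x₊, T θ⟩` and variance `v = ‖θ₋‖²_Γ + σ²`, so its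
information about `t` is `⟨x₊, T h⟩² / v + 2 ⟨θ₋, Γ h₋⟩² / v²`. By Cauchy–Schwarz for `Γ` and the
Schur decomposition `hᵀ Σ h = (T h)ᵀ Σ₊ (T h) + ‖h₋‖²_Γ`, its average over the features is at most
`2 hᵀ Σ h / v`, so that the `n` samples of all agents carry information at most `n hᵀ (Cˢ)⁻¹ h`.
The least favourable direction `h = Cˢ w` gives the bound `wᵀ Cˢ w`.

Rows belonging to different `n` may be dependent, so instead of the strong law of large numbers a
Chernoff bound and the Borel–Cantelli lemma control the empirical second moments of the features.
-/

noncomputable section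

section RegularModel

/-- A parametric family of laws `Q t`, `t ∈ ℝ`, that is regular enough for the van Trees
inequality: `Q t` has density `p t` with respect to `ν`, and the score `s t y = ∂ₜ log (p t y)` is
centred and square integrable. The derivative of the density is written as `s * p`, so that `p` may
vanish. -/
structure IsRegularModel {Y : Type*} [MeasurableSpace Y] (Q : ℝ → Measure Y) (ν : Measure Y)
    (p s : ℝ → Y → ℝ) : Prop where
  isProbabilityMeasure : ∀ t, IsProbabilityMeasure (Q t)
  eq_withDensity : ∀ t, Q t = ν.withDensity fun y => ENNReal.ofReal (p t y)
  nonneg : ∀ t y, 0 ≤ p t y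
  measurable_density : Measurable (Function.uncurry p)
  measurable_score : Measurable (Function.uncurry s)
  hasDerivAt_density : ∀ t y, HasDerivAt (fun t => p t y) (s t y * p t y) t
  continuous_score : ∀ y, Continuous fun t => s t y
  memLp_score : ∀ t, MemLp (s t) 2 (Q t)
  integral_score : ∀ t, ∫ y, s t y ∂(Q t) = 0

/-- The Fisher information at `t` of the family of laws `Q` with score `s`. -/
def fisherInfo {Y : Type*} [MeasurableSpace Y] (Q : ℝ → Measure Y) (s : ℝ → Y → ℝ) (t : ℝ) : ℝ :=
  ∫ y, s t y ^ 2 ∂(Q t)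

lemma fisherInfo_nonneg {Y : Type*} [MeasurableSpace Y] (Q : ℝ → Measure Y) (s : ℝ → Y → ℝ)
    (t : ℝ) : 0 ≤ fisherInfo Q s t :=
  integral_nonneg fun y => sq_nonneg (s t y)

/-- The joint law of `(t, y)` when `t` is uniform (unnormalized) on `(a, b]` and `y` has density
`p t` with respect to `ν`. -/
def jointLaw {Y : Type*} [MeasurableSpace Y] (ν : Measure Y) (p : ℝ → Y → ℝ) (a b : ℝ) :
    Measure (ℝ × Y) :=
  ((volume.restrict (Set.Ioc a b)).prod ν).withDensity fun z => ENNReal.ofReal (p z.1 z.2)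

lemma ofReal_integral_mul_sq_le {α : Type*} [MeasurableSpace α] {μ : Measure α} {f g : α → ℝ}
    (hf : AEMeasurable f μ) (hg : AEMeasurable g μ) :
    ENNReal.ofReal ((∫ x, f x * g x ∂μ) ^ 2) ≤
      (∫⁻ x, ENNReal.ofReal (f x ^ 2) ∂μ) * ∫⁻ x, ENNReal.ofReal (g x ^ 2) ∂μ := by
  have hsq (r : ℝ) : ENNReal.ofReal (r ^ 2) = ‖r‖ₑ ^ (2 : ℝ) := by
    rw [ENNReal.rpow_two, ← ofReal_norm, ← ENNReal.ofReal_pow (norm_nonneg r),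
      Real.norm_eq_abs, sq_abs]
  simp_rw [hsq]
  have holder : ‖∫ x, f x * g x ∂μ‖ₑ ≤
      (∫⁻ x, ‖f x‖ₑ ^ (2 : ℝ) ∂μ) ^ (1 / 2 : ℝ) * (∫⁻ x, ‖g x‖ₑ ^ (2 : ℝ) ∂μ) ^ (1 / 2 : ℝ) := by
    refine (enorm_integral_le_lintegral_enorm _).trans ?_
    simp_rw [enorm_mul]
    exact ENNReal.lintegral_mul_le_Lp_mul_Lq μ .two_two hf.enorm hg.enorm
  refine (ENNReal.rpow_le_rpow holder zero_le_two).trans_eq ?_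
  rw [ENNReal.mul_rpow_of_nonneg _ _ zero_le_two, ← ENNReal.rpow_mul, ← ENNReal.rpow_mul]
  norm_num

lemma memLp_two_of_lintegral_sq_ne_top {α : Type*} [MeasurableSpace α] {μ : Measure α} {f : α → ℝ}
    (hf : AEStronglyMeasurable f μ) (h : ∫⁻ x, ENNReal.ofReal (f x ^ 2) ∂μ ≠ ∞) : MemLp f 2 μ :=
  (memLp_two_iff_integrable_sq hf).2 ⟨hf.pow 2,
    (hasFiniteIntegral_iff_ofReal (.of_forall fun x => sq_nonneg (f x))).2 h.lt_top⟩

lemma setLIntegral_Ioc_ofReal {a b : ℝ} (hab : a ≤ b) {f : ℝ → ℝ} (hf : Continuous f)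
    (hf0 : ∀ t ∈ Set.Ioc a b, 0 ≤ f t) :
    ∫⁻ t in Set.Ioc a b, ENNReal.ofReal (f t) = ENNReal.ofReal (∫ t in a..b, f t) := by
  rw [intervalIntegral.integral_of_le hab, ofReal_integral_eq_lintegral_ofReal
    hf.integrableOn_Ioc (ae_restrict_of_forall_mem measurableSet_Ioc hf0)]

namespace IsRegularModel

variable {Y : Type*} [MeasurableSpace Y] {Q : ℝ → Measure Y} {ν : Measure Y} {p s : ℝ → Y → ℝ}
  {a b : ℝ}

lemma continuous_density (h : IsRegularModel Q ν p s) (y : Y) : Continuous fun t => p t y :=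
  continuous_iff_continuousAt.2 fun t => (h.hasDerivAt_density t y).continuousAt

lemma integrable_density (h : IsRegularModel Q ν p s) (t : ℝ) : Integrable (p t) ν := by
  have := h.isProbabilityMeasure t
  refine ⟨(h.measurable_density.comp measurable_prodMk_left).aestronglyMeasurable,
    (hasFiniteIntegral_iff_ofReal (.of_forall (h.nonneg t))).2 ?_⟩
  rw [← setLIntegral_univ, ← withDensity_apply _ .univ, ← h.eq_withDensity]
  exact measure_lt_top _ _

lemma variance_score (h : IsRegularModel Q ν p s) (t : ℝ) :
    Var[s t; Q t] = fisherInfo Q s t :=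
  variance_of_integral_eq_zero (h.memLp_score t).aemeasurable (h.integral_score t)

lemma lintegral_affine_score_sq (h : IsRegularModel Q ν p s) (t α β : ℝ) :
    ∫⁻ y, ENNReal.ofReal ((α * s t y + β) ^ 2) ∂(Q t) =
      ENNReal.ofReal (α ^ 2 * fisherInfo Q s t + β ^ 2) := by
  have := h.isProbabilityMeasure t
  have hs : Integrable (s t) (Q t) := (h.memLp_score t).integrable one_le_two
  have hs2 : Integrable (fun y => s t y ^ 2) (Q t) := (h.memLp_score t).integrable_sq
  have hsum : Integrable (fun y => α ^ 2 * s t y ^ 2 + 2 * α * β * s t y) (Q t) :=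
    (hs2.const_mul _).add (hs.const_mul _)
  have expand (y : Y) :
      (α * s t y + β) ^ 2 = α ^ 2 * s t y ^ 2 + 2 * α * β * s t y + β ^ 2 := by ring
  rw [← ofReal_integral_eq_lintegral_ofReal
    (by simpa only [expand] using! hsum.add (integrable_const _))
    (.of_forall fun y => sq_nonneg _)]
  simp_rw [expand]
  rw [integral_add hsum (integrable_const _),
    integral_add (hs2.const_mul _) (hs.const_mul _), integral_const_mul, integral_const_mul,
    h.integral_score, fisherInfo]
  simp

lemma lintegral_jointLaw [SFinite ν] (h : IsRegularModel Q ν p s) {f : ℝ × Y → ℝ≥0∞}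
    (hf : Measurable f) :
    ∫⁻ z, f z ∂(jointLaw ν p a b) = ∫⁻ t in Set.Ioc a b, ∫⁻ y, f (t, y) ∂(Q t) := by
  have hp : Measurable fun z : ℝ × Y => ENNReal.ofReal (p z.1 z.2) :=
    h.measurable_density.ennreal_ofReal
  rw [jointLaw, lintegral_withDensity_eq_lintegral_mul _ hp hf,
    lintegral_prod _ (hp.mul hf).aemeasurable]
  refine lintegral_congr fun t => ?_
  rw [h.eq_withDensity t]
  exact (lintegral_withDensity_eq_lintegral_mul ν (hp.comp measurable_prodMk_left)
    (hf.comp measurable_prodMk_left)).symm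

lemma measurePreserving_fst_jointLaw [SFinite ν] (h : IsRegularModel Q ν p s) :
    MeasurePreserving Prod.fst (jointLaw ν p a b) (volume.restrict (Set.Ioc a b)) := by
  refine ⟨measurable_fst, Measure.ext_of_lintegral _ fun f hf => ?_⟩
  rw [lintegral_map hf measurable_fst, h.lintegral_jointLaw (by fun_prop)]
  refine lintegral_congr fun t => ?_
  have := h.isProbabilityMeasure t
  simp

lemma integral_jointLaw [SFinite ν] (h : IsRegularModel Q ν p s) (hab : a ≤ b) {f : ℝ × Y → ℝ}
    (hf : Integrable f (jointLaw ν p a b)) :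
    ∫ z, f z ∂(jointLaw ν p a b) = ∫ y, (∫ t in a..b, f (t, y) * p t y) ∂ν := by
  have hp : Measurable fun z : ℝ × Y => ENNReal.ofReal (p z.1 z.2) :=
    h.measurable_density.ennreal_ofReal
  have hp_lt_top : ∀ᵐ z ∂(volume.restrict (Set.Ioc a b)).prod ν,
      ENNReal.ofReal (p z.1 z.2) < ∞ := .of_forall fun z => ENNReal.ofReal_lt_top
  rw [jointLaw, integrable_withDensity_iff hp hp_lt_top] at hf
  rw [jointLaw, integral_withDensity_eq_integral_toReal_smul hp hp_lt_top]
  simp only [ENNReal.toReal_ofReal (h.nonneg _ _), smul_eq_mul, mul_comm (p _ _)] at hf ⊢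
  rw [integral_prod_symm _ hf]
  simp_rw [intervalIntegral.integral_of_le hab]

lemma integral_weighted_score (h : IsRegularModel Q ν p s) {w w' ψ ψ' : ℝ → ℝ}
    (hw : ∀ t, HasDerivAt w (w' t) t) (hw' : Continuous w') (hwa : w a = 0) (hwb : w b = 0)
    (hψ : ∀ t, HasDerivAt ψ (ψ' t) t) (hψ' : Continuous ψ') (c : ℝ) (y : Y) :
    ∫ t in a..b, w t * (c - ψ t) * (w t * s t y + 2 * w' t) * p t y =
      ∫ t in a..b, ψ' t * w t ^ 2 * p t y := by
  have hp := h.continuous_density y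
  have hs := h.continuous_score y
  have hwc : Continuous w := continuous_iff_continuousAt.2 fun t => (hw t).continuousAt
  have hderiv (t : ℝ) : HasDerivAt (fun t => w t ^ 2 * p t y)
      (w t * (w t * s t y + 2 * w' t) * p t y) t := by
    convert! ((hw t).fun_pow 2).mul (h.hasDerivAt_density t y) using 1
    ring
  have by_parts := intervalIntegral.integral_mul_deriv_eq_deriv_mul (a := a) (b := b)
    (fun t _ => (hψ t).const_sub c) (fun t _ => hderiv t)
    (hψ'.neg.intervalIntegrable _ _) (Continuous.intervalIntegrable (by fun_prop) _ _)
  simp only [hwa, hwb] at by_parts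
  calc _ = ∫ t in a..b, (c - ψ t) * (w t * (w t * s t y + 2 * w' t) * p t y) := by
        congr 1 with t; ring
    _ = _ := by
        rw [by_parts]
        simp [mul_assoc]

lemma lintegral_weighted_score_sq_le [SFinite ν] (h : IsRegularModel Q ν p s) (hab : a ≤ b)
    {w w' : ℝ → ℝ} (hw : Continuous w) (hw' : Continuous w') {K : ℝ}
    (hK : ∀ t ∈ Set.Ioc a b, fisherInfo Q s t ≤ K) :
    ∫⁻ z, ENNReal.ofReal ((w z.1 * s z.1 z.2 + 2 * w' z.1) ^ 2) ∂(jointLaw ν p a b) ≤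
      ENNReal.ofReal (∫ t in a..b, (w t ^ 2 * K + (2 * w' t) ^ 2)) := by
  have hs : Measurable fun z : ℝ × Y => s z.1 z.2 := h.measurable_score
  rw [h.lintegral_jointLaw (by fun_prop),
    ← setLIntegral_Ioc_ofReal hab (by fun_prop) fun t ht => ?_]
  · refine setLIntegral_mono' measurableSet_Ioc fun t ht => ?_
    simp only [h.lintegral_affine_score_sq]
    gcongr
    exact hK t ht
  · have := (fisherInfo_nonneg Q s t).trans (hK t ht)
    positivity

lemma lintegral_weighted_error_sq_le [SFinite ν] (h : IsRegularModel Q ν p s) (hab : a ≤ b)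
    {w ψ : ℝ → ℝ} (hw : Continuous w) (hψ : Continuous ψ) {g : Y → ℝ} (hg : Measurable g)
    {R : ℝ≥0∞} (hR : ∀ t ∈ Set.Ioc a b, ∫⁻ y, ENNReal.ofReal ((g y - ψ t) ^ 2) ∂(Q t) ≤ R) :
    ∫⁻ z, ENNReal.ofReal ((w z.1 * (g z.2 - ψ z.1)) ^ 2) ∂(jointLaw ν p a b) ≤
      R * ENNReal.ofReal (∫ t in a..b, w t ^ 2) := by
  rw [h.lintegral_jointLaw (by fun_prop), ← setLIntegral_Ioc_ofReal hab (by fun_prop)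
    fun t _ => sq_nonneg _, ← lintegral_const_mul _ (by fun_prop)]
  refine setLIntegral_mono' measurableSet_Ioc fun t ht => ?_
  simp only [mul_pow, ENNReal.ofReal_mul (sq_nonneg (w t))]
  rw [lintegral_const_mul _ (by fun_prop), mul_comm R]
  gcongr
  exact hR t ht

/-- **Van Trees inequality** for the prior with density proportional to `w ^ 2` on `(a, b]`. -/
theorem vanTrees [SFinite ν] (h : IsRegularModel Q ν p s) (hab : a ≤ b) {w w' ψ ψ' : ℝ → ℝ}
    (hw : ∀ t, HasDerivAt w (w' t) t) (hw' : Continuous w') (hwa : w a = 0) (hwb : w b = 0)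
    (hψ : ∀ t, HasDerivAt ψ (ψ' t) t) (hψ' : Continuous ψ')
    {K : ℝ} (hK : ∀ t ∈ Set.Ioc a b, fisherInfo Q s t ≤ K)
    {g : Y → ℝ} (hg : Measurable g) {R : ℝ≥0∞} (hR_top : R ≠ ∞)
    (hR : ∀ t ∈ Set.Ioc a b, ∫⁻ y, ENNReal.ofReal ((g y - ψ t) ^ 2) ∂(Q t) ≤ R) :
    ENNReal.ofReal ((∫ t in a..b, ψ' t * w t ^ 2) ^ 2) ≤
      R * ENNReal.ofReal (∫ t in a..b, w t ^ 2) *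
        ENNReal.ofReal (∫ t in a..b, (w t ^ 2 * K + (2 * w' t) ^ 2)) := by
  have hwc : Continuous w := continuous_iff_continuousAt.2 fun t => (hw t).continuousAt
  have hψc : Continuous ψ := continuous_iff_continuousAt.2 fun t => (hψ t).continuousAt
  set J := jointLaw ν p a b
  let A : ℝ × Y → ℝ := fun z => w z.1 * (g z.2 - ψ z.1)
  let B : ℝ × Y → ℝ := fun z => w z.1 * s z.1 z.2 + 2 * w' z.1
  have hs : Measurable fun z : ℝ × Y => s z.1 z.2 := h.measurable_score
  have hA : Measurable A := by fun_prop
  have hB : Measurable B := by fun_prop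
  have hA2 : ∫⁻ z, ENNReal.ofReal (A z ^ 2) ∂J ≤ R * ENNReal.ofReal (∫ t in a..b, w t ^ 2) :=
    h.lintegral_weighted_error_sq_le hab hwc hψc hg hR
  have hB2 : ∫⁻ z, ENNReal.ofReal (B z ^ 2) ∂J ≤
      ENNReal.ofReal (∫ t in a..b, (w t ^ 2 * K + (2 * w' t) ^ 2)) :=
    h.lintegral_weighted_score_sq_le hab hwc hw' hK
  have hAB : ∫ z, A z * B z ∂J = ∫ t in a..b, ψ' t * w t ^ 2 := by
    have hint : Integrable (fun z => A z * B z) J :=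
      (memLp_two_of_lintegral_sq_ne_top hA.aestronglyMeasurable
        (ne_top_of_le_ne_top (ENNReal.mul_ne_top hR_top ENNReal.ofReal_ne_top) hA2)).integrable_mul
      (memLp_two_of_lintegral_sq_ne_top hB.aestronglyMeasurable
        (ne_top_of_le_ne_top ENNReal.ofReal_ne_top hB2))
    have hfst := h.measurePreserving_fst_jointLaw (a := a) (b := b)
    have hprior : Integrable (fun z : ℝ × Y => ψ' z.1 * w z.1 ^ 2) J :=
      hfst.integrable_comp_of_integrable (g := fun t => ψ' t * w t ^ 2)
        (Continuous.integrableOn_Ioc (by fun_prop))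
    calc ∫ z, A z * B z ∂J = ∫ y, (∫ t in a..b, A (t, y) * B (t, y) * p t y) ∂ν :=
          h.integral_jointLaw hab hint
      _ = ∫ z, ψ' z.1 * w z.1 ^ 2 ∂J := by
          simp only [A, B, h.integral_weighted_score hw hw' hwa hwb hψ hψ']
          exact (h.integral_jointLaw hab hprior).symm
      _ = ∫ t in a..b, ψ' t * w t ^ 2 := by
          rw [intervalIntegral.integral_of_le hab, ← hfst.map_eq,
            integral_map measurable_fst.aemeasurable (by fun_prop)]
  rw [← hAB]
  exact (ofReal_integral_mul_sq_le hA.aemeasurable hB.aemeasurable).trans (by gcongr)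

lemma vanTrees_affine [SFinite ν] (h : IsRegularModel Q ν p s) {T K : ℝ} (hT : 0 < T)
    (hK : ∀ t ∈ Set.Ioc (-T) T, fisherInfo Q s t ≤ K) {g : Y → ℝ} (hg : Measurable g) {α β : ℝ}
    {R : ℝ≥0∞}
    (hR : ∀ t ∈ Set.Ioc (-T) T, ∫⁻ y, ENNReal.ofReal ((g y - (α + t * β)) ^ 2) ∂(Q t) ≤ R) :
    ENNReal.ofReal (β ^ 2 / (K + 10 / T ^ 2)) ≤ R := by
  rcases eq_or_ne R ∞ with rfl | hR_top
  · exact le_top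
  have hK0 : 0 ≤ K := (fisherInfo_nonneg Q s T).trans (hK T ⟨by linarith, le_rfl⟩)
  have hmass : ∫ t in (-T)..T, (T ^ 2 - t ^ 2) ^ 2 = 16 / 15 * T ^ 5 := by
    have expand (t : ℝ) : (T ^ 2 - t ^ 2) ^ 2 = T ^ 4 - 2 * T ^ 2 * t ^ 2 + t ^ 4 := by ring
    simp_rw [expand]
    rw [intervalIntegral.integral_add, intervalIntegral.integral_sub,
      intervalIntegral.integral_const_mul, integral_pow, integral_pow,
      intervalIntegral.integral_const]
    · simp only [smul_eq_mul]; push_cast; ring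
    all_goals exact Continuous.intervalIntegrable (by fun_prop) _ _
  have hinfo : ∫ t in (-T)..T, ((T ^ 2 - t ^ 2) ^ 2 * K + (2 * (-(2 * t))) ^ 2) =
      16 / 15 * T ^ 5 * (K + 10 / T ^ 2) := by
    simp_rw [mul_neg, ← mul_assoc, neg_sq, mul_pow]
    rw [intervalIntegral.integral_add, intervalIntegral.integral_mul_const, hmass,
      intervalIntegral.integral_const_mul, integral_pow]
    · field_simp; push_cast; ring
    all_goals exact Continuous.intervalIntegrable (by fun_prop) _ _
  -- The prior with density proportional to `(T ^ 2 - t ^ 2) ^ 2` has information `10 / T ^ 2`.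
  have key := h.vanTrees (a := -T) (b := T) (w := fun t => T ^ 2 - t ^ 2) (w' := fun t => -(2 * t))
    (by linarith) (fun t => by simpa using! (hasDerivAt_pow 2 t).const_sub (T ^ 2)) (by fun_prop)
    (by ring) (by ring) (fun t => ((hasDerivAt_id t).mul_const β).const_add α) (by fun_prop)
    hK hg hR_top hR
  simp only [one_mul] at key
  rw [intervalIntegral.integral_const_mul, hmass, hinfo] at key
  lift R to NNReal using hR_top
  rw [← ENNReal.ofReal_coe_nnreal, ← ENNReal.ofReal_mul (by positivity),
    ← ENNReal.ofReal_mul (by positivity), ENNReal.ofReal_le_ofReal_iff (by positivity)] at key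
  rw [← ENNReal.ofReal_coe_nnreal]
  refine ENNReal.ofReal_le_ofReal ((div_le_iff₀ (by positivity)).2 ?_)
  have hmass_pos : 0 < (16 / 15 * T ^ 5) ^ 2 := by positivity
  refine le_of_mul_le_mul_right ?_ hmass_pos
  linarith

end IsRegularModel

end RegularModel

section Pi

variable {ι : Type*} [Fintype ι] {Y : ι → Type*} [∀ i, MeasurableSpace (Y i)]
  {Q : ∀ i, ℝ → Measure (Y i)} {ν : ∀ i, Measure (Y i)}
  {p s : ∀ i, ℝ → Y i → ℝ}

lemma withDensity_pi_ofReal [∀ i, SigmaFinite (ν i)] {f : ∀ i, Y i → ℝ}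
    (hf : ∀ i, Integrable (f i) (ν i)) (hf0 : ∀ i y, 0 ≤ f i y) :
    (Measure.pi ν).withDensity (fun y => ENNReal.ofReal (∏ i, f i (y i))) =
      Measure.pi fun i => (ν i).withDensity fun y => ENNReal.ofReal (f i y) := by
  have (i : ι) : IsFiniteMeasure ((ν i).withDensity fun y => ENNReal.ofReal (f i y)) :=
    isFiniteMeasure_withDensity_ofReal (hf i).2
  refine (Measure.pi_eq fun B hB => ?_).symm
  rw [withDensity_apply _ (MeasurableSet.univ_pi hB), Measure.restrict_pi_pi,
    ← ofReal_integral_eq_lintegral_ofReal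
      (Integrable.fintype_prod_dep fun i => (hf i).restrict)
      (.of_forall fun y => Finset.prod_nonneg fun i _ => hf0 i (y i)),
    integral_fintype_prod_eq_prod,
    ENNReal.ofReal_prod_of_nonneg fun i _ => integral_nonneg (hf0 i)]
  refine Finset.prod_congr rfl fun i _ => ?_
  rw [withDensity_apply _ (hB i),
    ofReal_integral_eq_lintegral_ofReal (hf i).restrict (.of_forall (hf0 i))]

namespace IsRegularModel

lemma memLp_sum_score (h : ∀ i, IsRegularModel (Q i) (ν i) (p i) (s i)) (t : ℝ) :
    MemLp (fun y : ∀ i, Y i => ∑ i, s i t (y i)) 2 (Measure.pi fun i => Q i t) := by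
  have (i : ι) := (h i).isProbabilityMeasure t
  exact memLp_finsetSum _ fun i _ =>
    ((h i).memLp_score t).comp_measurePreserving (measurePreserving_eval _ i)

lemma integral_sum_score (h : ∀ i, IsRegularModel (Q i) (ν i) (p i) (s i)) (t : ℝ) :
    ∫ y, ∑ i, s i t (y i) ∂(Measure.pi fun i => Q i t) = 0 := by
  have (i : ι) := (h i).isProbabilityMeasure t
  have heval (i : ι) := measurePreserving_eval (fun i => Q i t) i
  have hint (i : ι) : Integrable (fun y : ∀ i, Y i => s i t (y i)) (Measure.pi fun i => Q i t) :=
    (heval i).integrable_comp_of_integrable (((h i).memLp_score t).integrable one_le_two)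
  rw [integral_finsetSum _ fun i _ => hint i]
  refine Finset.sum_eq_zero fun i _ => ?_
  rw [← (h i).integral_score t, ← (heval i).map_eq, integral_map
    (heval i).measurable.aemeasurable (by simpa only [(heval i).map_eq] using!
      ((h i).memLp_score t).aestronglyMeasurable)]

protected lemma pi [∀ i, SigmaFinite (ν i)] (h : ∀ i, IsRegularModel (Q i) (ν i) (p i) (s i)) :
    IsRegularModel (fun t => Measure.pi fun i => Q i t) (Measure.pi ν)
      (fun t y => ∏ i, p i t (y i)) (fun t y => ∑ i, s i t (y i)) where
  isProbabilityMeasure t := by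
    have (i : ι) := (h i).isProbabilityMeasure t
    infer_instance
  eq_withDensity t := by
    rw [withDensity_pi_ofReal (fun i => (h i).integrable_density t) fun i => (h i).nonneg t]
    simp_rw [← (h _).eq_withDensity]
  nonneg t y := Finset.prod_nonneg fun i _ => (h i).nonneg t (y i)
  measurable_density := Finset.measurable_prod _ fun i _ => (h i).measurable_density.comp
    (measurable_fst.prodMk ((measurable_pi_apply i).comp measurable_snd))
  measurable_score := Finset.measurable_sum _ fun i _ => (h i).measurable_score.comp
    (measurable_fst.prodMk ((measurable_pi_apply i).comp measurable_snd))
  hasDerivAt_density t y := by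
    classical
    convert! HasDerivAt.fun_finsetProd (u := Finset.univ)
      (fun i _ => (h i).hasDerivAt_density t (y i)) using 1
    rw [Finset.sum_mul]
    refine Finset.sum_congr rfl fun i _ => ?_
    rw [← Finset.mul_prod_erase _ _ (Finset.mem_univ i), smul_eq_mul]
    ring
  continuous_score y := continuous_finsetSum _ fun i _ => (h i).continuous_score (y i)
  memLp_score := memLp_sum_score h
  integral_score := integral_sum_score h

lemma fisherInfo_pi [∀ i, SigmaFinite (ν i)] (h : ∀ i, IsRegularModel (Q i) (ν i) (p i) (s i))
    (t : ℝ) :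
    fisherInfo (fun t => Measure.pi fun i => Q i t) (fun t (y : ∀ i, Y i) => ∑ i, s i t (y i)) t =
      ∑ i, fisherInfo (Q i) (s i) t := by
  have (i : ι) := (h i).isProbabilityMeasure t
  rw [← (IsRegularModel.pi h).variance_score t]
  simp_rw [← (h _).variance_score t, ← variance_sum_pi fun i => (h i).memLp_score t,
    Finset.sum_fn]

end IsRegularModel

end Pi

section Gaussian

lemma hasDerivAt_gaussianPDFReal (m : ℝ) {v : NNReal} (hv : v ≠ 0) (y : ℝ) :
    HasDerivAt (gaussianPDFReal m v) (-((y - m) / v) * gaussianPDFReal m v y) y := by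
  have hv0 : (v : ℝ) ≠ 0 := by exact_mod_cast hv
  rw [gaussianPDFReal_def]
  convert! ((((hasDerivAt_id y).sub_const m).fun_pow 2).fun_neg.div_const
    (2 * (v : ℝ))).exp.const_mul (√(2 * Real.pi * v))⁻¹ using 1
  simp only [id_eq]
  field_simp
  push_cast
  ring

/-- **Stein's identity**. -/
lemma integral_sub_mul_gaussianReal {m : ℝ} {v : NNReal} {f f' : ℝ → ℝ}
    (hf : ∀ y, HasDerivAt f (f' y) y) (hint : Integrable f (gaussianReal m v))
    (hint' : Integrable f' (gaussianReal m v))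
    (hint_mul : Integrable (fun y => (y - m) * f y) (gaussianReal m v)) :
    ∫ y, (y - m) * f y ∂(gaussianReal m v) = v * ∫ y, f' y ∂(gaussianReal m v) := by
  rcases eq_or_ne v 0 with rfl | hv
  · simp
  have hv0 : (v : ℝ) ≠ 0 := by exact_mod_cast hv
  have to_volume {g : ℝ → ℝ} (hg : Integrable g (gaussianReal m v)) :
      Integrable fun y => gaussianPDFReal m v y * g y := by
    rw [gaussianReal_of_var_ne_zero m hv,
      integrable_withDensity_iff (measurable_gaussianPDF m v)
        (.of_forall fun y => gaussianPDF_lt_top)] at hg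
    simpa only [toReal_gaussianPDF, mul_comm] using! hg
  have hderiv (y : ℝ) : HasDerivAt (fun y => gaussianPDFReal m v y * f y)
      (gaussianPDFReal m v y * (f' y - (y - m) * f y / v)) y := by
    convert! (hasDerivAt_gaussianPDFReal m hv y).mul (hf y) using 1
    ring
  have hzero : ∫ y, (f' y - (y - m) * f y / v) ∂(gaussianReal m v) = 0 := by
    rw [integral_gaussianReal_eq_integral_smul hv]
    exact integral_eq_zero_of_hasDerivAt_of_integrable hderiv
      (to_volume (hint'.sub (hint_mul.div_const _))) (to_volume hint)
  rw [integral_sub hint' (hint_mul.div_const _), integral_div, sub_eq_zero] at hzero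
  rw [hzero, mul_div_cancel₀ _ hv0]

lemma integrable_sub_pow_gaussianReal (m : ℝ) (v : NNReal) (k : ℕ) :
    Integrable (fun y => (y - m) ^ k) (gaussianReal m v) := by
  have hmem : MemLp (fun y => y - m) k (gaussianReal m v) :=
    (memLp_id_gaussianReal k).sub (memLp_const m)
  refine (integrable_norm_iff (by fun_prop)).1 ?_
  simpa only [norm_pow] using hmem.integrable_norm_pow'

lemma integral_sub_pow_add_two_gaussianReal (m : ℝ) (v : NNReal) (k : ℕ) :
    ∫ y, (y - m) ^ (k + 2) ∂(gaussianReal m v) =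
      v * ((k + 1) * ∫ y, (y - m) ^ k ∂(gaussianReal m v)) := by
  have hderiv (y : ℝ) : HasDerivAt (fun y => (y - m) ^ (k + 1)) ((k + 1) * (y - m) ^ k) y := by
    simpa using! ((hasDerivAt_id y).sub_const m).fun_pow (k + 1)
  have hmul (y : ℝ) : (y - m) ^ (k + 2) = (y - m) * (y - m) ^ (k + 1) := by ring
  simp_rw [hmul]
  rw [integral_sub_mul_gaussianReal hderiv (integrable_sub_pow_gaussianReal m v _)
    ((integrable_sub_pow_gaussianReal m v k).const_mul _)
    (by simpa only [hmul] using integrable_sub_pow_gaussianReal m v (k + 2)), integral_const_mul]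

lemma integral_sub_gaussianReal (m : ℝ) (v : NNReal) :
    ∫ y, (y - m) ∂(gaussianReal m v) = 0 := by
  have hint : Integrable (fun y => y) (gaussianReal m v) :=
    (memLp_id_gaussianReal 1).integrable le_rfl
  rw [integral_sub hint (integrable_const _)]
  simp

lemma integral_sub_sq_gaussianReal (m : ℝ) (v : NNReal) :
    ∫ y, (y - m) ^ 2 ∂(gaussianReal m v) = v := by
  simpa using integral_sub_pow_add_two_gaussianReal m v 0

/-- The score of the curve `t ↦ N(m t, v t)` at a point with mean `m`, variance `v` and velocities
`m'`, `v'`. -/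
def gaussianScore (m v m' v' y : ℝ) : ℝ :=
  m' / v * (y - m) + v' / (2 * v ^ 2) * ((y - m) ^ 2 - v)

section Score

variable (m m' v' : ℝ) {v : ℝ}

lemma memLp_gaussianScore : MemLp (gaussianScore m v m' v') 2 (gaussianReal m v.toNNReal) := by
  have hmem (p : NNReal) : MemLp (fun y => y - m) p (gaussianReal m v.toNNReal) :=
    (memLp_id_gaussianReal p).sub (memLp_const m)
  have hsq : MemLp (fun y => (y - m) ^ 2) 2 (gaussianReal m v.toNNReal) := by
    rw [memLp_two_iff_integrable_sq (by fun_prop)]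
    simpa only [← pow_mul] using integrable_sub_pow_gaussianReal m v.toNNReal (2 * 2)
  exact ((hmem 2).const_mul _).add ((hsq.sub (memLp_const v)).const_mul _)

lemma integral_gaussianScore (hv : 0 ≤ v) :
    ∫ y, gaussianScore m v m' v' y ∂(gaussianReal m v.toNNReal) = 0 := by
  have hpow := integrable_sub_pow_gaussianReal m v.toNNReal
  have h1 : Integrable (fun y => y - m) (gaussianReal m v.toNNReal) := by simpa using hpow 1
  have h2 : Integrable (fun y => (y - m) ^ 2 - v) (gaussianReal m v.toNNReal) :=
    (hpow 2).sub (integrable_const _)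
  simp only [gaussianScore]
  rw [integral_add (h1.const_mul _) (h2.const_mul _), integral_const_mul, integral_const_mul,
    integral_sub (hpow 2) (integrable_const _), integral_sub_gaussianReal,
    integral_sub_sq_gaussianReal, Real.coe_toNNReal v hv]
  simp

lemma integral_gaussianScore_sq (hv : 0 < v) :
    ∫ y, gaussianScore m v m' v' y ^ 2 ∂(gaussianReal m v.toNNReal) =
      m' ^ 2 / v + v' ^ 2 / (2 * v ^ 2) := by
  have hpow := integrable_sub_pow_gaussianReal m v.toNNReal
  have third : ∫ y, (y - m) ^ 3 ∂(gaussianReal m v.toNNReal) = 0 := by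
    simpa [integral_sub_gaussianReal] using integral_sub_pow_add_two_gaussianReal m v.toNNReal 1
  have fourth : ∫ y, (y - m) ^ 4 ∂(gaussianReal m v.toNNReal) = 3 * v ^ 2 := by
    rw [integral_sub_pow_add_two_gaussianReal m _ 2, integral_sub_sq_gaussianReal,
      Real.coe_toNNReal v hv.le]
    push_cast
    ring
  set α := m' / v with hα
  set β := v' / (2 * v ^ 2) with hβ
  have expand (y : ℝ) : gaussianScore m v m' v' y ^ 2 = β ^ 2 * (y - m) ^ 4 +
      2 * α * β * (y - m) ^ 3 + (α ^ 2 - 2 * β ^ 2 * v) * (y - m) ^ 2 -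
      2 * α * β * v * (y - m) ^ 1 + β ^ 2 * v ^ 2 := by
    simp only [gaussianScore, ← hα, ← hβ]
    ring
  simp_rw [expand]
  rw [integral_add, integral_sub, integral_add, integral_add]
  · simp only [integral_const_mul, fourth, third, integral_sub_sq_gaussianReal, pow_one,
      integral_sub_gaussianReal, integral_const, Real.coe_toNNReal v hv.le]
    simp only [probReal_univ, smul_eq_mul, hα, hβ]
    field_simp
    ring
  all_goals fun_prop

end Score

section Curve

variable {m v m' v' : ℝ → ℝ}

lemma hasDerivAt_gaussianPDFReal_curve {m' v' t : ℝ} (hv : ∀ t, 0 < v t) (hm' : HasDerivAt m m' t)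
    (hv' : HasDerivAt v v' t) (y : ℝ) :
    HasDerivAt (fun t => gaussianPDFReal (m t) (v t).toNNReal y)
      (gaussianScore (m t) (v t) m' v' y * gaussianPDFReal (m t) (v t).toNNReal y) t := by
  have eq_exp (t : ℝ) : gaussianPDFReal (m t) (v t).toNNReal y =
      Real.exp (-(Real.log (2 * Real.pi * v t) / 2) - (y - m t) ^ 2 / (2 * v t)) := by
    have := hv t
    rw [gaussianPDFReal, Real.coe_toNNReal _ (hv t).le, sub_eq_add_neg (-_), Real.exp_add,
      Real.exp_neg, Real.exp_half, Real.exp_log (by positivity), neg_div]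
  have hvt := hv t
  have hexp := (((((hv'.const_mul (2 * Real.pi)).log (by positivity)).div_const 2).neg.sub
    (((hm'.const_sub y).fun_pow 2).div (hv'.const_mul 2) (by positivity)))).exp
  simp only [eq_exp]
  convert! hexp using 1
  rw [mul_comm, gaussianScore]
  congr 1
  field_simp
  push_cast
  ring

lemma isRegularModel_gaussianReal (hv : ∀ t, 0 < v t) (hm' : ∀ t, HasDerivAt m (m' t) t)
    (hv' : ∀ t, HasDerivAt v (v' t) t) (hm'c : Continuous m') (hv'c : Continuous v') :
    IsRegularModel (fun t => gaussianReal (m t) (v t).toNNReal) volume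
      (fun t => gaussianPDFReal (m t) (v t).toNNReal)
      (fun t => gaussianScore (m t) (v t) (m' t) (v' t)) := by
  have hmc : Continuous m := continuous_iff_continuousAt.2 fun t => (hm' t).continuousAt
  have hvc : Continuous v := continuous_iff_continuousAt.2 fun t => (hv' t).continuousAt
  exact {
    isProbabilityMeasure := inferInstance
    eq_withDensity t := gaussianReal_of_var_ne_zero _ (by simpa using hv t)
    nonneg t := gaussianPDFReal_nonneg _ _
    measurable_density := measurable_uncurry_gaussianPDFReal.comp
      (by fun_prop : Measurable fun z : ℝ × ℝ => (m z.1, (v z.1).toNNReal, z.2))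
    measurable_score := by
      simp only [Function.uncurry_def, gaussianScore]
      fun_prop
    hasDerivAt_density t y := hasDerivAt_gaussianPDFReal_curve hv (hm' t) (hv' t) y
    continuous_score y := by
      have hv0 (t : ℝ) : v t ≠ 0 := (hv t).ne'
      have hv2 (t : ℝ) : 2 * v t ^ 2 ≠ 0 := by simpa using hv0 t
      simp only [gaussianScore]
      fun_prop (disch := assumption)
    memLp_score t := memLp_gaussianScore _ _ _
    integral_score t := integral_gaussianScore _ _ _ (hv t).le }

end Curve

end Gaussian

section RowSums

open scoped Topology

lemma exists_exp_mul_mgf_lt_one {E : Type*} [MeasurableSpace E] {ν : Measure E}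
    [IsProbabilityMeasure ν] {f : E → ℝ} (h0 : 0 ∈ interior (integrableExpSet f ν)) {b : ℝ}
    (hb : ∫ x, f x ∂ν < b) :
    ∃ s, 0 < s ∧ s ∈ integrableExpSet f ν ∧ Real.exp (-s * b) * mgf f ν s < 1 := by
  have hderiv : HasDerivAt (fun s => Real.exp (-s * b) * mgf f ν s - 1) (∫ x, f x ∂ν - b) 0 := by
    have hexp : HasDerivAt (fun s => Real.exp (-s * b)) (-b) 0 := by
      simpa using! ((hasDerivAt_neg (0 : ℝ)).mul_const b).exp
    simpa [sub_eq_add_neg, add_comm] using! (hexp.fun_mul (hasDerivAt_mgf h0)).sub_const 1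
  have hsign := eventually_nhdsWithin_sign_eq_of_deriv_neg
    (by rw [hderiv.deriv]; exact sub_neg.2 hb) (by simp)
  have hlt : ∀ᶠ s in 𝓝[>] (0 : ℝ), Real.exp (-s * b) * mgf f ν s < 1 := by
    filter_upwards [hsign.filter_mono nhdsWithin_le_nhds,
      self_mem_nhdsWithin] with s hs (hs0 : 0 < s)
    rw [sign_neg (sub_neg.2 hs0), sign_eq_neg_one_iff] at hs
    exact sub_neg.1 hs
  have hmem : ∀ᶠ s in 𝓝[>] (0 : ℝ), s ∈ integrableExpSet f ν :=
    mem_nhdsWithin_of_mem_nhds (mem_interior_iff_mem_nhds.1 h0)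
  obtain ⟨s, hs, hmem, hlt⟩ := (eventually_mem_nhdsWithin.and (hmem.and hlt)).exists
  exact ⟨s, hs, hmem, hlt⟩

variable {Ω E : Type*} [MeasurableSpace Ω] [MeasurableSpace E] {P : Measure Ω} {ν : Measure E}
  {f : E → ℝ}

lemma measureReal_le_sum_le_pow {n : ℕ} {X : Fin n → Ω → E} (hlaw : ∀ k, HasLaw (X k) ν P)
    (hindep : iIndepFun X P) (hf : Measurable f) {s : ℝ} (hs : 0 ≤ s)
    (hmem : s ∈ integrableExpSet f ν) (b : ℝ) :
    P.real {ω | n * b ≤ ∑ k, f (X k ω)} ≤ (Real.exp (-s * b) * mgf f ν s) ^ n := by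
  have := hindep.isProbabilityMeasure
  have hindep' : iIndepFun (fun k => f ∘ X k) P := hindep.comp (fun _ => f) fun _ => hf
  have hmeas (k) : AEMeasurable (f ∘ X k) P := hf.comp_aemeasurable (hlaw k).aemeasurable
  have hmgf (k) : mgf (f ∘ X k) P s = mgf f ν s := by
    rw [← (hlaw k).map_eq, mgf_map (hlaw k).aemeasurable (by fun_prop)]
  have hint : Integrable (fun ω => Real.exp (s * (∑ k, f ∘ X k) ω)) P := by
    rw [← mgf_pos_iff, hindep'.mgf_sum₀ hmeas]
    refine Finset.prod_pos fun k _ => ?_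
    have : IsProbabilityMeasure ν := (hlaw k).isProbabilityMeasure_iff.1 ‹_›
    exact hmgf k ▸ mgf_pos hmem
  have hchernoff := measure_ge_le_exp_mul_mgf (n * b) hs hint
  simp only [hindep'.mgf_sum₀ hmeas, hmgf, Finset.prod_const, Finset.card_univ,
    Fintype.card_fin, Finset.sum_apply, Function.comp_apply] at hchernoff
  rwa [mul_left_comm, Real.exp_nat_mul, ← mul_pow] at hchernoff

-- No joint law is assumed across rows, so the laws of large numbers for a single i.i.d. sequence
-- do not apply: the exponentially small row probabilities are summed by Borel–Cantelli.
lemma ae_eventually_sum_le [IsProbabilityMeasure P] {X : (n : ℕ) → Fin n → Ω → E}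
    (hlaw : ∀ n k, HasLaw (X n k) ν P)
    (hindep : ∀ n, iIndepFun (X n) P) (hf : Measurable f)
    (h0 : 0 ∈ interior (integrableExpSet f ν)) :
    ∀ᵐ ω ∂P, ∀ δ > 0, ∀ᶠ n : ℕ in atTop, ∑ k, f (X n k ω) ≤ n * (∫ x, f x ∂ν + δ) := by
  have : IsProbabilityMeasure ν := (hlaw 1 0).isProbabilityMeasure_iff.1 ‹_›
  have ae_of_pos (δ : ℝ) (hδ : 0 < δ) :
      ∀ᵐ ω ∂P, ∀ᶠ n : ℕ in atTop, ∑ k, f (X n k ω) ≤ n * (∫ x, f x ∂ν + δ) := by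
    obtain ⟨s, hs, hmem, hlt⟩ := exists_exp_mul_mgf_lt_one h0 (lt_add_of_pos_right _ hδ)
    have hsummable : Summable fun n : ℕ =>
        P.real {ω | n * (∫ x, f x ∂ν + δ) ≤ ∑ k, f (X n k ω)} :=
      .of_nonneg_of_le (fun _ => measureReal_nonneg)
        (fun n => measureReal_le_sum_le_pow (hlaw n) (hindep n) hf hs.le hmem _)
        (summable_geometric_of_lt_one (mul_nonneg (Real.exp_pos _).le mgf_nonneg) hlt)
    have hsum : ∑' n : ℕ, P {ω | n * (∫ x, f x ∂ν + δ) ≤ ∑ k, f (X n k ω)} ≠ ∞ :=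
      (tsum_congr fun n => ofReal_measureReal).symm.trans_ne hsummable.tsum_ofReal_ne_top
    filter_upwards [ae_eventually_notMem hsum] with ω hω
    exact hω.mono fun n hn => (not_le.1 hn).le
  filter_upwards [ae_all_iff.2 fun j : ℕ => ae_of_pos (1 / (j + 1)) (by positivity)]
    with ω hω δ hδ
  obtain ⟨j, hj⟩ := exists_nat_one_div_lt hδ
  exact (hω j).mono fun n hn => hn.trans (by gcongr)

end RowSums

section SecondMoments

lemma zero_mem_interior_integrableExpSet_inner_sq {E : Type*} [NormedAddCommGroup E]
    [InnerProductSpace ℝ E] [MeasurableSpace E] [OpensMeasurableSpace E] {ν : Measure E}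
    (hν : ∃ C, 0 < C ∧ Integrable (fun x => Real.exp (C * ‖x‖ ^ 2)) ν) (z : E) :
    0 ∈ interior (integrableExpSet (fun x => inner ℝ x z ^ 2) ν) := by
  obtain ⟨C, hC, hint⟩ := hν
  refine mem_interior.2 ⟨{s | s * ‖z‖ ^ 2 < C}, fun s (hs : s * ‖z‖ ^ 2 < C) => ?_,
    isOpen_lt (by fun_prop) continuous_const, by simpa using hC⟩
  refine hint.mono' (by fun_prop) (.of_forall fun x => ?_)
  rw [Real.norm_of_nonneg (Real.exp_pos _).le, Real.exp_le_exp]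
  have hsq : inner ℝ x z ^ 2 ≤ ‖z‖ ^ 2 * ‖x‖ ^ 2 := by
    rw [← mul_pow, mul_comm]
    exact sq_le_sq' (neg_le_of_abs_le (abs_real_inner_le_norm x z)) (real_inner_le_norm x z)
  rcases le_total s 0 with hs0 | hs0
  · exact (mul_nonpos_of_nonpos_of_nonneg hs0 (sq_nonneg _)).trans (by positivity)
  · calc s * inner ℝ x z ^ 2 ≤ s * (‖z‖ ^ 2 * ‖x‖ ^ 2) := by gcongr
      _ = s * ‖z‖ ^ 2 * ‖x‖ ^ 2 := (mul_assoc ..).symm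
      _ ≤ C * ‖x‖ ^ 2 := by gcongr

variable {ι : Type*} [Fintype ι] [DecidableEq ι] {S : Matrix ι ι ℝ}

lemma variance_inner_multivariateGaussian (μ a : EuclideanSpace ℝ ι) (hS : S.PosSemidef) :
    Var[fun x => inner ℝ x a; multivariateGaussian μ S] = a.ofLp ⬝ᵥ S *ᵥ a.ofLp := by
  rw [← covarianceBilin_multivariateGaussian (μ := μ) hS,
    covarianceBilin_self IsGaussian.memLp_two_id]
  simp_rw [real_inner_comm]

lemma integral_inner_multivariateGaussian (μ a : EuclideanSpace ℝ ι) (S : Matrix ι ι ℝ) :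
    ∫ x, inner ℝ x a ∂multivariateGaussian μ S = inner ℝ μ a := by
  simp_rw [real_inner_comm a]
  rw [integral_inner IsGaussian.integrable_fun_id, integral_id_multivariateGaussian]

lemma integral_inner_sq_multivariateGaussian (a : EuclideanSpace ℝ ι) (hS : S.PosSemidef) :
    ∫ x, inner ℝ x a ^ 2 ∂multivariateGaussian 0 S = a.ofLp ⬝ᵥ S *ᵥ a.ofLp := by
  rw [← variance_inner_multivariateGaussian 0 a hS, variance_of_integral_eq_zero (by fun_prop)
    (by rw [integral_inner_multivariateGaussian, inner_zero_left])]

lemma map_inner_multivariateGaussian (μ a : EuclideanSpace ℝ ι) (hS : S.PosSemidef) :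
    (multivariateGaussian μ S).map (fun x => inner ℝ x a)
      = gaussianReal (inner ℝ μ a) (a.ofLp ⬝ᵥ S *ᵥ a.ofLp).toNNReal := by
  rw [← integral_inner_multivariateGaussian μ a S, ← variance_inner_multivariateGaussian μ a hS]
  simpa [real_inner_comm] using
    IsGaussian.map_eq_gaussianReal (μ := multivariateGaussian μ S) (innerSL ℝ a)

end SecondMoments

namespace AgentView

variable {d : ℕ} (V : AgentView d) {S : Matrix (Fin d) (Fin d) ℝ}

/-- The effective parameter `T θ = θ₊ + Σ₊⁻¹ Σ_± θ₋` of an agent: its labels have conditional mean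
`⟨x₊, T θ⟩`. -/
def effParam (S : Matrix (Fin d) (Fin d) ℝ) :
    EuclideanSpace ℝ (Fin d) →ₗ[ℝ] EuclideanSpace ℝ (Fin V.numObs) :=
  Matrix.toLpLin 2 2 (V.T S)

lemma mis_add_smul (θ h : EuclideanSpace ℝ (Fin d)) (t : ℝ) :
    V.mis (θ + t • h) = V.mis θ + t • V.mis h := rfl

/-- The polar form `⟨θ₋, Γ₋ h₋⟩` of the quadratic form `misVar`. -/
def misCov (S : Matrix (Fin d) (Fin d) ℝ) (θ h : EuclideanSpace ℝ (Fin d)) : ℝ :=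
  (V.mis θ).ofLp ⬝ᵥ V.schur S *ᵥ (V.mis h).ofLp

lemma blockPlus_posDef (hS : S.PosDef) : (V.blockPlus S).PosDef :=
  hS.submatrix (V.perm.injective.comp Sum.inl_injective)

lemma conjTranspose_blockPM (hS : S.IsHermitian) : (V.blockPM S)ᴴ = V.blockMP S := by
  rw [blockPM, Matrix.conjTranspose_submatrix, hS.eq, blockMP]

lemma submatrix_perm (S : Matrix (Fin d) (Fin d) ℝ) : S.submatrix V.perm V.perm
    = Matrix.fromBlocks (V.blockPlus S) (V.blockPM S) (V.blockMP S) (V.blockMinus S) := by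
  ext (i | i) (j | j) <;> rfl

lemma comp_perm (v : EuclideanSpace ℝ (Fin d)) :
    v.ofLp ∘ V.perm = Sum.elim (V.obs v).ofLp (V.mis v).ofLp := by
  ext (i | i) <;> rfl

lemma schur_posSemidef (hS : S.PosDef) : (V.schur S).PosSemidef := by
  have hP := V.blockPlus_posDef hS
  have := hP.isUnit.invertible
  have hperm := hS.posSemidef.submatrix V.perm
  rw [submatrix_perm, ← V.conjTranspose_blockPM hS.isHermitian, hP.fromBlocks₁₁] at hperm
  rwa [schur, ← V.conjTranspose_blockPM hS.isHermitian]

lemma effParam_apply (S : Matrix (Fin d) (Fin d) ℝ) (v : EuclideanSpace ℝ (Fin d)) :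
    (V.effParam S v).ofLp
      = (V.obs v).ofLp + ((V.blockPlus S)⁻¹ * V.blockPM S) *ᵥ (V.mis v).ofLp := by
  rw [effParam, Matrix.ofLp_toLpLin, Matrix.toLin'_apply, T, Matrix.submatrix_mulVec_equiv,
    Equiv.symm_symm, comp_perm, Matrix.fromCols_mulVec_sumElim, Matrix.one_mulVec,
    Function.comp_id]

lemma dotProduct_mulVec_eq_add_misVar (hS : S.PosDef) (v : EuclideanSpace ℝ (Fin d)) :
    v.ofLp ⬝ᵥ S *ᵥ v.ofLp
      = (V.effParam S v).ofLp ⬝ᵥ V.blockPlus S *ᵥ (V.effParam S v).ofLp + V.misVar S v := by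
  have hP := V.blockPlus_posDef hS
  have := hP.isUnit.invertible
  have hschur := Matrix.schur_complement_eq₁₁ (V.blockPM S) (V.blockMinus S) (V.obs v).ofLp
    (V.mis v).ofLp hP.isHermitian
  rw [V.conjTranspose_blockPM hS.isHermitian, ← submatrix_perm, ← effParam_apply] at hschur
  simp only [star_trivial, ← comp_perm, ← Matrix.dotProduct_mulVec] at hschur
  rw [misVar, schur, ← hschur, Matrix.submatrix_mulVec_equiv, Function.comp_assoc,
    Equiv.self_comp_symm, Function.comp_id, comp_equiv_dotProduct_comp_equiv]

lemma inner_obs_add_inner_condMean (hS : S.PosDef) (θ : EuclideanSpace ℝ (Fin d))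
    (x : EuclideanSpace ℝ (Fin V.numObs)) :
    inner ℝ x (V.obs θ) + inner ℝ (V.condMean S x) (V.mis θ) = inner ℝ x (V.effParam S θ) := by
  have htrans : V.blockMP S * (V.blockPlus S)⁻¹ = ((V.blockPlus S)⁻¹ * V.blockPM S)ᵀ := by
    rw [← V.conjTranspose_blockPM hS.isHermitian, ← Matrix.conjTranspose_eq_transpose_of_trivial,
      Matrix.conjTranspose_mul, (V.blockPlus_posDef hS).isHermitian.inv.eq]
  simp only [EuclideanSpace.inner_eq_star_dotProduct, star_trivial, effParam_apply, condMean,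
    htrans, add_dotProduct]
  rw [Matrix.mulVec_transpose, dotProduct_comm _ x.ofLp, dotProduct_comm _ x.ofLp,
    dotProduct_comm _ (_ ᵥ* _), Matrix.dotProduct_mulVec]

lemma misVar_nonneg (hS : S.PosDef) (θ : EuclideanSpace ℝ (Fin d)) : 0 ≤ V.misVar S θ := by
  simpa [misVar] using (V.schur_posSemidef hS).dotProduct_mulVec_nonneg (V.mis θ).ofLp

lemma misVar_add_smul (hS : S.PosDef) (θ h : EuclideanSpace ℝ (Fin d)) (t : ℝ) :
    V.misVar S (θ + t • h) = V.misVar S θ + 2 * t * V.misCov S θ h + t ^ 2 * V.misVar S h := by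
  have hcomm : (V.mis h).ofLp ⬝ᵥ V.schur S *ᵥ (V.mis θ).ofLp = V.misCov S θ h := by
    rw [misCov, Matrix.dotProduct_mulVec, ← Matrix.mulVec_transpose,
      ← Matrix.conjTranspose_eq_transpose_of_trivial, (V.schur_posSemidef hS).isHermitian.eq,
      dotProduct_comm]
  simp only [misVar, mis_add_smul, WithLp.ofLp_add, WithLp.ofLp_smul, Matrix.mulVec_add,
    Matrix.mulVec_smul, add_dotProduct, dotProduct_add, smul_dotProduct, dotProduct_smul, hcomm,
    smul_eq_mul]
  rw [misCov]
  ring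

lemma misCov_sq_le (hS : S.PosDef) (θ h : EuclideanSpace ℝ (Fin d)) :
    V.misCov S θ h ^ 2 ≤ V.misVar S θ * V.misVar S h := by
  have hdiscrim : discrim (V.misVar S h) (2 * V.misCov S θ h) (V.misVar S θ) ≤ 0 :=
    discrim_le_zero fun t => by
      linarith [V.misVar_nonneg hS (θ + t • h), V.misVar_add_smul hS θ h t]
  rw [discrim] at hdiscrim
  linarith

/-- The variance `‖θ₋‖²_{Γ₋} + σ²` of a label given the observed features. -/
def labelVar (S : Matrix (Fin d) (Fin d) ℝ) (σ : ℝ) (θ : EuclideanSpace ℝ (Fin d)) : ℝ :=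
  V.misVar S θ + σ ^ 2

lemma labelVar_pos (hS : S.PosDef) {σ : ℝ} (hσ : 0 < σ) (θ : EuclideanSpace ℝ (Fin d)) :
    0 < V.labelVar S σ θ :=
  add_pos_of_nonneg_of_pos (V.misVar_nonneg hS θ) (by positivity)

@[fun_prop]
lemma continuous_labelVar (S : Matrix (Fin d) (Fin d) ℝ) (σ : ℝ) :
    Continuous (V.labelVar S σ) := by
  unfold labelVar misVar mis
  fun_prop

@[fun_prop]
lemma continuous_misCov_left (S : Matrix (Fin d) (Fin d) ℝ) (h : EuclideanSpace ℝ (Fin d)) :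
    Continuous fun θ => V.misCov S θ h := by
  unfold misCov mis
  fun_prop

lemma hasDerivAt_labelVar_line (hS : S.PosDef) (σ : ℝ) (θ h : EuclideanSpace ℝ (Fin d)) (t : ℝ) :
    HasDerivAt (fun t : ℝ => V.labelVar S σ (θ + t • h)) (2 * V.misCov S (θ + t • h) h) t := by
  have hcov : V.misCov S (θ + t • h) h = V.misCov S θ h + t * V.misVar S h := by
    simp [misCov, misVar, mis_add_smul]
  simp only [labelVar, V.misVar_add_smul hS, hcov]
  have hlin : HasDerivAt (fun t => 2 * t * V.misCov S θ h) (2 * V.misCov S θ h) t := by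
    simpa using! ((hasDerivAt_id t).const_mul 2).mul_const (V.misCov S θ h)
  have hquad : HasDerivAt (fun t => t ^ 2 * V.misVar S h) (2 * t * V.misVar S h) t := by
    simpa using! ((hasDerivAt_id t).pow 2).mul_const (V.misVar S h)
  convert! ((hlin.const_add (V.misVar S θ)).add hquad).add_const (σ ^ 2) using 1
  ring

lemma labelLaw_eq_gaussianReal (hS : S.PosDef) (σ : ℝ) (θ : EuclideanSpace ℝ (Fin d))
    (x : EuclideanSpace ℝ (Fin V.numObs)) :
    V.labelLaw S σ θ x
      = gaussianReal (inner ℝ x (V.effParam S θ)) (V.labelVar S σ θ).toNNReal := by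
  set μ := multivariateGaussian (V.condMean S x) (V.schur S)
  set γ := gaussianReal 0 (σ ^ 2).toNNReal
  have hsum : (μ.prod γ).map (fun p => inner ℝ p.1 (V.mis θ) + p.2)
      = gaussianReal (inner ℝ (V.condMean S x) (V.mis θ)) (V.labelVar S σ θ).toNNReal := by
    have hprod := Measure.map_prod_map μ γ (f := fun x => inner ℝ x (V.mis θ)) (g := id)
      (by fun_prop) measurable_id
    rw [Measure.map_id] at hprod
    rw [labelVar, Real.toNNReal_add (V.misVar_nonneg hS θ) (sq_nonneg σ),
      ← add_zero (inner ℝ _ _), ← gaussianReal_conv_gaussianReal, misVar,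
      ← map_inner_multivariateGaussian _ _ (V.schur_posSemidef hS), Measure.conv, hprod,
      Measure.map_map (by fun_prop) (by fun_prop)]
    rfl
  rw [← V.inner_obs_add_inner_condMean hS, add_comm (inner ℝ x _), ← gaussianReal_map_const_add,
    ← hsum, Measure.map_map (by fun_prop) (by fun_prop), labelLaw]
  congr 1
  ext p
  exact add_assoc ..

/-- Fisher information of one label at `θ` in the direction `h`, where `q` stands for the squared
derivative `⟨x₊, T h⟩²` of its conditional mean (or an average of those over several samples). -/
def labelInfo (S : Matrix (Fin d) (Fin d) ℝ) (σ : ℝ) (θ h : EuclideanSpace ℝ (Fin d)) (q : ℝ) :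
    ℝ :=
  q / V.labelVar S σ θ + 2 * V.misCov S θ h ^ 2 / V.labelVar S σ θ ^ 2

/-- The score at `θ` of one label of an agent with observed features `x`, in the direction `h`. -/
def labelScore (S : Matrix (Fin d) (Fin d) ℝ) (σ : ℝ)
    (θ h : EuclideanSpace ℝ (Fin d)) (x : EuclideanSpace ℝ (Fin V.numObs)) : ℝ → ℝ :=
  gaussianScore (inner ℝ x (V.effParam S θ)) (V.labelVar S σ θ) (inner ℝ x (V.effParam S h))
    (2 * V.misCov S θ h)

lemma isRegularModel_labelLaw (hS : S.PosDef) {σ : ℝ} (hσ : 0 < σ) (θ h : EuclideanSpace ℝ (Fin d))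
    (x : EuclideanSpace ℝ (Fin V.numObs)) :
    IsRegularModel (fun t : ℝ => V.labelLaw S σ (θ + t • h) x) volume
      (fun t => gaussianPDFReal (inner ℝ x (V.effParam S (θ + t • h)))
        (V.labelVar S σ (θ + t • h)).toNNReal)
      (fun t => V.labelScore S σ (θ + t • h) h x) := by
  simp_rw [V.labelLaw_eq_gaussianReal hS]
  refine isRegularModel_gaussianReal (fun t => V.labelVar_pos hS hσ (θ + t • h)) (fun t => ?_)
    (fun t => V.hasDerivAt_labelVar_line hS σ θ h t) continuous_const (by fun_prop)
  simpa [map_add, inner_add_right, inner_smul_right] using!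
    (hasDerivAt_mul_const (inner ℝ x (V.effParam S h))).const_add (inner ℝ x (V.effParam S θ))

lemma fisherInfo_labelLaw (hS : S.PosDef) {σ : ℝ} (hσ : 0 < σ) (θ h : EuclideanSpace ℝ (Fin d))
    (x : EuclideanSpace ℝ (Fin V.numObs)) (t : ℝ) :
    fisherInfo (fun t : ℝ => V.labelLaw S σ (θ + t • h) x)
        (fun t => V.labelScore S σ (θ + t • h) h x) t
      = V.labelInfo S σ (θ + t • h) h (inner ℝ x (V.effParam S h) ^ 2) := by
  have hv := V.labelVar_pos hS hσ (θ + t • h)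
  rw [fisherInfo, V.labelLaw_eq_gaussianReal hS]
  simp only [labelScore, integral_gaussianScore_sq _ _ _ hv, labelInfo]
  field_simp

lemma labelInfo_le (hS : S.PosDef) {σ : ℝ} (hσ : 0 < σ) (θ h : EuclideanSpace ℝ (Fin d)) :
    V.labelInfo S σ θ h ((V.effParam S h).ofLp ⬝ᵥ V.blockPlus S *ᵥ (V.effParam S h).ofLp)
      ≤ 2 / V.labelVar S σ θ * (h.ofLp ⬝ᵥ S *ᵥ h.ofLp) := by
  have hv := V.labelVar_pos hS hσ θ
  have hq : 0 ≤ (V.effParam S h).ofLp ⬝ᵥ V.blockPlus S *ᵥ (V.effParam S h).ofLp := by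
    simpa using (V.blockPlus_posDef hS).posSemidef.dotProduct_mulVec_nonneg (V.effParam S h).ofLp
  have hcov : V.misCov S θ h ^ 2 ≤ V.labelVar S σ θ * V.misVar S h :=
    (V.misCov_sq_le hS θ h).trans <| mul_le_mul_of_nonneg_right
      (le_add_of_nonneg_right (sq_nonneg σ)) (V.misVar_nonneg hS h)
  rw [V.dotProduct_mulVec_eq_add_misVar hS h, labelInfo]
  set q := (V.effParam S h).ofLp ⬝ᵥ V.blockPlus S *ᵥ (V.effParam S h).ofLp
  set v := V.labelVar S σ θ
  calc q / v + 2 * V.misCov S θ h ^ 2 / v ^ 2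
      ≤ 2 * q / v + 2 * (v * V.misVar S h) / v ^ 2 := by gcongr; linarith
    _ = 2 / v * (q + V.misVar S h) := by field_simp

end AgentView

section Submodel

variable {d m : ℕ} (V : Fin m → AgentView d) {S : Matrix (Fin d) (Fin d) ℝ} {σ : ℝ}

lemma isRegularModel_labelsLaw (hS : S.PosDef) (hσ : 0 < σ) (θ h : EuclideanSpace ℝ (Fin d))
    {n : ℕ} (x : ObsFeatures V n) :
    IsRegularModel (fun t : ℝ => labelsLaw V S σ x (θ + t • h))
      (Measure.pi fun _ => Measure.pi fun _ => volume)
      (fun t y => ∏ i, ∏ k, gaussianPDFReal (inner ℝ (x i k) ((V i).effParam S (θ + t • h)))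
        ((V i).labelVar S σ (θ + t • h)).toNNReal (y i k))
      (fun t y => ∑ i, ∑ k, (V i).labelScore S σ (θ + t • h) h (x i k) (y i k)) :=
  .pi fun i => .pi fun k => (V i).isRegularModel_labelLaw hS hσ θ h (x i k)

lemma fisherInfo_labelsLaw (hS : S.PosDef) (hσ : 0 < σ) (θ h : EuclideanSpace ℝ (Fin d))
    {n : ℕ} (x : ObsFeatures V n) (t : ℝ) :
    fisherInfo (fun t : ℝ => labelsLaw V S σ x (θ + t • h))
        (fun t y => ∑ i, ∑ k, (V i).labelScore S σ (θ + t • h) h (x i k) (y i k)) t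
      = ∑ i, ∑ k, (V i).labelInfo S σ (θ + t • h) h
          (inner ℝ (x i k) ((V i).effParam S h) ^ 2) := by
  have hmodel (i k) := (V i).isRegularModel_labelLaw hS hσ θ h (x i k)
  have hinner (i) := IsRegularModel.fisherInfo_pi (hmodel i) t
  simp only [(V _).fisherInfo_labelLaw hS hσ] at hinner
  simp only [← hinner]
  exact IsRegularModel.fisherInfo_pi (fun i => IsRegularModel.pi (hmodel i)) t

end Submodel

section Risk

open scoped Topology

namespace AgentView

variable {d : ℕ} (V : AgentView d) {S : Matrix (Fin d) (Fin d) ℝ}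

lemma continuous_labelInfo (hS : S.PosDef) {σ : ℝ} (hσ : 0 < σ) (h : EuclideanSpace ℝ (Fin d)) :
    Continuous fun z : EuclideanSpace ℝ (Fin d) × ℝ => V.labelInfo S σ z.1 h z.2 := by
  have hv (θ) : V.labelVar S σ θ ≠ 0 := (V.labelVar_pos hS hσ θ).ne'
  unfold labelInfo
  exact (continuous_snd.div (by fun_prop) fun _ => hv _).add
    (.div (by fun_prop) (by fun_prop) fun _ => pow_ne_zero 2 (hv _))

lemma sum_labelInfo_le (hS : S.PosDef) {σ : ℝ} (hσ : 0 < σ) (θ h : EuclideanSpace ℝ (Fin d))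
    {n : ℕ} {r : Fin n → ℝ} {q : ℝ} (hr : ∑ k, r k ≤ n * q) :
    ∑ k, V.labelInfo S σ θ h (r k) ≤ n * V.labelInfo S σ θ h q := by
  have hv := V.labelVar_pos hS hσ θ
  simp only [labelInfo, Finset.sum_add_distrib, ← Finset.sum_div, Finset.sum_const,
    Finset.card_univ, Fintype.card_fin, nsmul_eq_mul, mul_add, ← mul_div_assoc]
  gcongr

end AgentView

variable {d m s : ℕ} (V : Fin m → AgentView d) {S : Matrix (Fin d) (Fin d) ℝ} {σ : ℝ}
  {ψ : EuclideanSpace ℝ (Fin d) → EuclideanSpace ℝ (Fin s)} {u : EuclideanSpace ℝ (Fin s)}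
  {w : EuclideanSpace ℝ (Fin d)} (θ : EuclideanSpace ℝ (Fin d)) {h : EuclideanSpace ℝ (Fin d)}

lemma le_localMinimaxRisk (hS : S.PosDef) (hσ : 0 < σ)
    (hψ : ∀ θ', inner ℝ u (ψ θ') = inner ℝ w θ') (hh : h ≠ 0) {n : ℕ} (hn : 0 < n)
    (x : ObsFeatures V n) {c K : ℝ} (hc : 0 < c)
    (hK : ∀ t, |t| ≤ c / (√n * ‖h‖) → ∑ i, ∑ k, (V i).labelInfo S σ (θ + t • h) h
      (inner ℝ (x i k) ((V i).effParam S h) ^ 2) ≤ n * K) :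
    ENNReal.ofReal (inner ℝ w h ^ 2 / (K + 10 * ‖h‖ ^ 2 / c ^ 2))
      ≤ localMinimaxRisk V S σ ψ θ c n x u := by
  have hn' : (0 : ℝ) < n := Nat.cast_pos.2 hn
  have hnorm : 0 < ‖h‖ := norm_pos_iff.2 hh
  have hsqrt : √(n : ℝ) ^ 2 = n := Real.sq_sqrt hn'.le
  set T := c / (√n * ‖h‖) with hT
  have abs_le_of_mem {t : ℝ} (ht : t ∈ Set.Ioc (-T) T) : |t| ≤ T := abs_le.2 ⟨ht.1.le, ht.2⟩
  refine le_iInf₂ fun est hest => ?_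
  set R := ⨆ θ' ∈ Metric.closedBall θ (c / √(n : ℝ)), (n : ℝ≥0∞) *
    ∫⁻ y, ENNReal.ofReal (inner ℝ u (est (y, x) - ψ θ') ^ 2) ∂(labelsLaw V S σ x θ')
  have hrisk (t : ℝ) (ht : t ∈ Set.Ioc (-T) T) :
      ∫⁻ y, ENNReal.ofReal ((√n * inner ℝ u (est (y, x))
        - (√n * inner ℝ w θ + t * (√n * inner ℝ w h))) ^ 2) ∂(labelsLaw V S σ x (θ + t • h))
        ≤ R := by
    have hball : θ + t • h ∈ Metric.closedBall θ (c / √(n : ℝ)) := by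
      rw [mem_closedBall_iff_norm, add_sub_cancel_left, norm_smul, Real.norm_eq_abs]
      calc |t| * ‖h‖ ≤ T * ‖h‖ := by gcongr; exact abs_le_of_mem ht
        _ = c / √(n : ℝ) := by rw [hT]; field_simp
    refine le_of_eq_of_le ?_ (le_iSup₂_of_le _ hball le_rfl)
    rw [← lintegral_const_mul _ (by fun_prop)]
    refine lintegral_congr fun y => ?_
    rw [← ENNReal.ofReal_natCast, ← ENNReal.ofReal_mul n.cast_nonneg, inner_sub_right, hψ,
      inner_add_right, inner_smul_right]
    congr 1
    linear_combination
      (inner ℝ u (est (y, x)) - (inner ℝ w θ + t * inner ℝ w h)) ^ 2 * hsqrt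
  refine le_of_eq_of_le (congrArg _ ?_) <| (isRegularModel_labelsLaw V hS hσ θ h x).vanTrees_affine
    (T := T) (K := n * K) (div_pos hc (mul_pos (Real.sqrt_pos.2 hn') hnorm))
    (fun t ht => (fisherInfo_labelsLaw V hS hσ θ h x t).trans_le (hK t (abs_le_of_mem ht)))
    (by fun_prop) hrisk
  rw [hT, div_pow, mul_pow, mul_pow, hsqrt]
  field_simp

variable {q : Fin m → ℝ} {x : (n : ℕ) → ObsFeatures V n}

lemma eventually_sum_labelInfo_le (hS : S.PosDef) (hσ : 0 < σ) (hh : h ≠ 0)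
    (hx : ∀ i, ∀ δ > 0, ∀ᶠ n : ℕ in atTop,
      ∑ k, inner ℝ (x n i k) ((V i).effParam S h) ^ 2 ≤ n * (q i + δ))
    {K : ℝ} (hK : ∑ i, (V i).labelInfo S σ θ h (q i) < K) (c : ℝ) :
    ∀ᶠ n : ℕ in atTop, ∀ t, |t| ≤ c / (√n * ‖h‖) → ∑ i, ∑ k, (V i).labelInfo S σ (θ + t • h) h
      (inner ℝ (x n i k) ((V i).effParam S h) ^ 2) ≤ n * K := by
  have hcont : Continuous fun z : ℝ × ℝ =>
      ∑ i, (V i).labelInfo S σ (θ + z.1 • h) h (q i + z.2) :=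
    continuous_finsetSum _ fun i _ => ((V i).continuous_labelInfo hS hσ h).comp
      (f := fun z : ℝ × ℝ => (θ + z.1 • h, q i + z.2)) (by fun_prop)
  obtain ⟨ε, hε, hball⟩ := Metric.eventually_nhds_iff.1 <|
    (hcont.tendsto (0, 0)).eventually_lt_const (by simpa using hK)
  have hradius : Tendsto (fun n : ℕ => c / (√n * ‖h‖)) atTop (𝓝 0) :=
    tendsto_const_nhds.div_atTop ((Real.tendsto_sqrt_atTop.comp
      tendsto_natCast_atTop_atTop).atTop_mul_const (norm_pos_iff.2 hh))
  filter_upwards [hradius.eventually_lt_const hε,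
    eventually_all.2 fun i => hx i (ε / 2) (half_pos hε)] with n hn hxn t ht
  have hdist : dist (t, ε / 2) (0, 0) < ε := by
    rw [Prod.dist_eq, Real.dist_0_eq_abs, Real.dist_0_eq_abs, abs_of_pos (half_pos hε)]
    exact max_lt (ht.trans_lt hn) (half_lt_self hε)
  calc ∑ i, ∑ k, (V i).labelInfo S σ (θ + t • h) h (inner ℝ (x n i k) ((V i).effParam S h) ^ 2)
      ≤ ∑ i, n * (V i).labelInfo S σ (θ + t • h) h (q i + ε / 2) :=
        Finset.sum_le_sum fun i _ => (V i).sum_labelInfo_le hS hσ _ h (hxn i)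
    _ = n * ∑ i, (V i).labelInfo S σ (θ + t • h) h (q i + ε / 2) := (Finset.mul_sum ..).symm
    _ ≤ n * K := by gcongr; exact (hball hdist).le

lemma le_liminf_liminf_localMinimaxRisk (hS : S.PosDef) (hσ : 0 < σ)
    (hψ : ∀ θ', inner ℝ u (ψ θ') = inner ℝ w θ') (hh : h ≠ 0)
    (hx : ∀ i, ∀ δ > 0, ∀ᶠ n : ℕ in atTop,
      ∑ k, inner ℝ (x n i k) ((V i).effParam S h) ^ 2 ≤ n * (q i + δ))
    {I : ℝ} (hI0 : 0 < I) (hI : ∑ i, (V i).labelInfo S σ θ h (q i) ≤ I) :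
    ENNReal.ofReal (inner ℝ w h ^ 2 / I) ≤ liminf (fun c : ℝ => liminf (fun n : ℕ =>
      localMinimaxRisk V S σ ψ θ c n (x n) u) atTop) atTop := by
  have of_lt (K : ℝ) (hK : I < K) :
      ENNReal.ofReal (inner ℝ w h ^ 2 / K) ≤ liminf (fun c : ℝ => liminf (fun n : ℕ =>
        localMinimaxRisk V S σ ψ θ c n (x n) u) atTop) atTop := by
    have hlim : Tendsto (fun c : ℝ => inner ℝ w h ^ 2 / (K + 10 * ‖h‖ ^ 2 / c ^ 2)) atTop
        (𝓝 (inner ℝ w h ^ 2 / K)) := by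
      have hpenalty : Tendsto (fun c : ℝ => 10 * ‖h‖ ^ 2 / c ^ 2) atTop (𝓝 0) :=
        tendsto_const_nhds.div_atTop (tendsto_pow_atTop two_ne_zero)
      simpa only [add_zero] using! tendsto_const_nhds.div (hpenalty.const_add K)
        (by simpa only [add_zero] using (hI0.trans hK).ne')
    rw [← (ENNReal.tendsto_ofReal hlim).liminf_eq]
    refine liminf_le_liminf ?_
    filter_upwards [eventually_gt_atTop 0] with c hc
    refine le_liminf_of_le (by isBoundedDefault) ?_
    filter_upwards [eventually_gt_atTop 0,
      eventually_sum_labelInfo_le V θ hS hσ hh hx (hI.trans_lt hK) c] with n hn hinfo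
    exact le_localMinimaxRisk V θ hS hσ hψ hh hn (x n) hc hinfo
  have hlim : Tendsto (fun K => ENNReal.ofReal (inner ℝ w h ^ 2 / K)) (𝓝[>] I)
      (𝓝 (ENNReal.ofReal (inner ℝ w h ^ 2 / I))) :=
    ENNReal.tendsto_ofReal <| tendsto_const_nhds.div
      (tendsto_id.mono_left nhdsWithin_le_nhds) hI0.ne'
  exact le_of_tendsto hlim (eventually_mem_nhdsWithin.mono of_lt)

lemma dotProduct_mulVec_inv {ι : Type*} [Fintype ι] [DecidableEq ι] (M : Matrix ι ι ℝ)
    (w : ι → ℝ) : (M⁻¹ *ᵥ w) ⬝ᵥ M *ᵥ (M⁻¹ *ᵥ w) = w ⬝ᵥ M⁻¹ *ᵥ w := by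
  by_cases hM : IsUnit M.det
  · rw [Matrix.mulVec_mulVec, Matrix.mul_nonsing_inv _ hM, Matrix.one_mulVec, dotProduct_comm]
  · simp [Matrix.nonsing_inv_apply_not_isUnit _ hM]

lemma le_liminf_liminf_localMinimaxRisk_of_strongBound (hS : S.PosDef) (hσ : 0 < σ)
    (hψ : ∀ θ', inner ℝ u (ψ θ') = inner ℝ w θ')
    (hh : h.ofLp = strongBound V S σ θ *ᵥ w.ofLp)
    (hx : ∀ i, ∀ δ > 0, ∀ᶠ n : ℕ in atTop, ∑ k, inner ℝ (x n i k) ((V i).effParam S h) ^ 2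
      ≤ n * ((V i).effParam S h ⬝ᵥ (V i).blockPlus S *ᵥ (V i).effParam S h + δ)) :
    ENNReal.ofReal (w.ofLp ⬝ᵥ strongBound V S σ θ *ᵥ w.ofLp) ≤ liminf (fun c : ℝ =>
      liminf (fun n : ℕ => localMinimaxRisk V S σ ψ θ c n (x n) u) atTop) atTop := by
  have hwh : inner ℝ w h = w.ofLp ⬝ᵥ strongBound V S σ θ *ᵥ w.ofLp := by
    rw [EuclideanSpace.inner_eq_star_dotProduct, star_trivial, hh, dotProduct_comm]
  rw [← hwh]
  rcases le_or_gt (inner ℝ w h) 0 with hle | hpos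
  · simp [ENNReal.ofReal_of_nonpos hle]
  have hinfo : ∑ i, (V i).labelInfo S σ θ h
      ((V i).effParam S h ⬝ᵥ (V i).blockPlus S *ᵥ (V i).effParam S h) ≤ inner ℝ w h := by
    calc _ ≤ ∑ i, 2 / (V i).labelVar S σ θ * (h.ofLp ⬝ᵥ S *ᵥ h.ofLp) :=
          Finset.sum_le_sum fun i _ => (V i).labelInfo_le hS hσ θ h
      _ = h.ofLp ⬝ᵥ (∑ i, (2 / (V i).labelVar S σ θ) • S) *ᵥ h.ofLp := by
          simp [Matrix.sum_mulVec, dotProduct_sum, Matrix.smul_mulVec]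
      _ = inner ℝ w h := by rw [hwh, hh]; exact dotProduct_mulVec_inv _ _
  have hh0 : h ≠ 0 := by rintro rfl; simp at hpos
  simpa [sq, hpos.ne'] using le_liminf_liminf_localMinimaxRisk V θ hS hσ hψ hh0 hx hpos hinfo

end Risk

theorem mainTheorem4_general {d m s : ℕ} (V : Fin m → AgentView d)
    {S : Matrix (Fin d) (Fin d) ℝ} (hS : S.PosDef) {σ : ℝ} (hσ : 0 < σ)
    (θ : EuclideanSpace ℝ (Fin d))
    {Ω : Type*} [MeasurableSpace Ω] {P : Measure Ω} [IsProbabilityMeasure P]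
    {X : (n : ℕ) → (i : Fin m) → Fin n → Ω → EuclideanSpace ℝ (Fin (V i).numObs)}
    {ν : (i : Fin m) → Measure (EuclideanSpace ℝ (Fin (V i).numObs))}
    (hlaw : ∀ n i k, HasLaw (X n i k) (ν i) P) (hindep : ∀ n i, iIndepFun (X n i) P)
    (hν : ∀ i, ∃ C, 0 < C ∧ Integrable (fun x => Real.exp (C * ‖x‖ ^ 2)) (ν i))
    (hcov : ∀ i z, ∫ x, inner ℝ x z ^ 2 ∂(ν i) = z.ofLp ⬝ᵥ (V i).blockPlus S *ᵥ z.ofLp)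
    (A : Matrix (Fin s) (Fin d) ℝ) (u : EuclideanSpace ℝ (Fin s)) :
    ∀ᵐ ω ∂P, ENNReal.ofReal (u.ofLp ⬝ᵥ ((A * strongBound V S σ θ * Aᵀ) *ᵥ u.ofLp)) ≤
      liminf (fun c : ℝ => liminf (fun n : ℕ =>
        localMinimaxRisk V S σ (fun θ' => WithLp.toLp 2 (A *ᵥ θ'.ofLp)) θ c n
          (fun i k => X n i k ω) u) atTop) atTop := by
  set w : EuclideanSpace ℝ (Fin d) := WithLp.toLp 2 (Aᵀ *ᵥ u.ofLp) with hw
  set h : EuclideanSpace ℝ (Fin d) := WithLp.toLp 2 (strongBound V S σ θ *ᵥ w.ofLp)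
  have htarget (θ' : EuclideanSpace ℝ (Fin d)) :
      inner ℝ u (WithLp.toLp 2 (A *ᵥ θ'.ofLp)) = inner ℝ w θ' := by
    simp only [EuclideanSpace.inner_eq_star_dotProduct, star_trivial, hw]
    rw [Matrix.mulVec_transpose, dotProduct_comm, dotProduct_comm θ'.ofLp,
      Matrix.dotProduct_mulVec]
  have hbound : u.ofLp ⬝ᵥ (A * strongBound V S σ θ * Aᵀ) *ᵥ u.ofLp
      = w.ofLp ⬝ᵥ strongBound V S σ θ *ᵥ w.ofLp := by
    rw [← Matrix.mulVec_mulVec, ← Matrix.mulVec_mulVec, Matrix.dotProduct_mulVec,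
      ← Matrix.mulVec_transpose]
  have hmoments (i : Fin m) := ae_eventually_sum_le (fun n k => hlaw n i k) (fun n => hindep n i)
    (by fun_prop) (zero_mem_interior_integrableExpSet_inner_sq (hν i) ((V i).effParam S h))
  filter_upwards [ae_all_iff.2 hmoments] with ω hω
  rw [hbound]
  exact le_liminf_liminf_localMinimaxRisk_of_strongBound V θ hS hσ htarget rfl
    fun i => by simpa only [hcov] using hω i

end

theorem mainTheorem4 {d m : ℕ} (V : Fin m → AgentView d)
    (S : Matrix (Fin d) (Fin d) ℝ) (hS : S.PosDef) (σ : ℝ) (hσ : 0 < σ)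
    (θ : EuclideanSpace ℝ (Fin d))
    {Ω : Type*} [MeasurableSpace Ω] (P : Measure Ω) [IsProbabilityMeasure P]
    (X : (n : ℕ) → (i : Fin m) → Fin n → Ω → EuclideanSpace ℝ (Fin (V i).numObs))
    (hlaw : ∀ n i k, HasLaw (X n i k) (multivariateGaussian 0 ((V i).blockPlus S)) P)
    (hindep : ∀ n i, iIndepFun (X n i) P) :
    (∀ u : EuclideanSpace ℝ (Fin d), ∀ᵐ ω ∂P,
      ENNReal.ofReal (u.ofLp ⬝ᵥ (strongBound V S σ θ *ᵥ u.ofLp)) ≤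
        liminf (fun c : ℝ => liminf (fun n : ℕ =>
          localMinimaxRisk V S σ id θ c n (fun i k => X n i k ω) u) atTop) atTop) ∧
    (∀ (i : Fin m) (u : EuclideanSpace ℝ (Fin (V i).numObs)), ∀ᵐ ω ∂P,
      ENNReal.ofReal (u.ofLp ⬝ᵥ
          (((V i).T S * strongBound V S σ θ * ((V i).T S)ᵀ) *ᵥ u.ofLp)) ≤
        liminf (fun c : ℝ => liminf (fun n : ℕ =>
          localMinimaxRisk V S σ (fun θ' => WithLp.toLp 2 ((V i).T S *ᵥ θ'.ofLp)) θ c n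
            (fun j k => X n j k ω) u) atTop) atTop) := by
  have general {s : ℕ} (A : Matrix (Fin s) (Fin d) ℝ) (u : EuclideanSpace ℝ (Fin s)) :=
    mainTheorem4_general V hS hσ θ hlaw hindep (fun i => IsGaussian.exists_integrable_exp_sq _)
      (fun i z => integral_inner_sq_multivariateGaussian z ((V i).blockPlus_posDef hS).posSemidef)
      A u
  refine ⟨fun u => ?_, fun i => general ((V i).T S)⟩
  simpa only [Matrix.one_mulVec, WithLp.toLp_ofLp, Matrix.one_mul, Matrix.transpose_one,
    Matrix.mul_one] using! general 1 u
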